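/- There exist an absolute constant $c_1>0$ and a function $c_0=c_0(\alpha,\delta,r,\kappa)>0$ such that the following holds. Let $0<\alpha<1$ and $\delta,\gamma,r,L>0$, let $n\ge 1$, let $\|\cdot\|$ be a norm on $\mathbb{R}^n$, and let $X$ be a symmetric random vector in $\mathbb{R}^n$ (that is, $X$ and $-X$ have the same distribution) such that for every $t\in\mathbb{R}^n$ $$\mathbb{P}\bigl(|\langle X,t\rangle|\ge \gamma\|t\|\bigr)\ge \delta \qquad\text{and}\qquad \bigl(\mathbb{E}|\langle X,t\rangle|^r\bigr)^{1/r}\le L\|t\|.$$ Let $N\ge c_0(\alpha,\delta,r,L/\gamma)\,n$ be an integer, put $p=\alpha\log(eN/n)$, and let $X_1,\dots,X_N$ be independent copies of $X$. Then, with probability at least $1-2\exp(-c_1N^{1-\alpha}n^{\alpha})$, $$\tfrac12\,\bigl(K_p(X)\bigr)^{\circ}\subset \mathrm{absconv}(X_1,\dots,X_N).$$ Here $\mathrm{absconv}(X_1,\dots,X_N)$ is the convex hull of $\pm X_1,\dots,\pm X_N$, $K_p(X)=\{t\in\mathbb{R}^n:\ \mathbb{P}(\langle X,t\rangle\ge 1)\le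 e^{-p}\}$ is the floating body, and $T^\circ=\{x\in\mathbb{R}^n:\ \langle t,x\rangle\le 1\text{ for every }t\in T\}$ denotes the polar of $T\subset\mathbb{R}^n$. -/

import Mathlib

open MeasureTheory ProbabilityTheory
open scoped Pointwise

namespace RandomPolytope

/-- `ℝⁿ` with its Euclidean inner product. -/
abbrev Rn (n : ℕ) : Type := EuclideanSpace ℝ (Fin n)

/-- A random vector is symmetric if `X` and `-X` have the same law. -/
def IsSymmetric {n : ℕ} {Ω : Type*} [MeasurableSpace Ω] (X : Ω → Rn n) (P : Measure Ω) : Prop :=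
  IdentDistrib X (fun ω => -X ω) P P

/-- The small-ball condition with respect to `ν` with constants `γ` and `δ`:
`P(|⟨X, t⟩| ≥ γ ν(t)) ≥ δ` for every `t`. -/
def SmallBall {n : ℕ} {Ω : Type*} [MeasurableSpace Ω] (X : Ω → Rn n) (P : Measure Ω)
    (ν : Seminorm ℝ (Rn n)) (γ δ : ℝ) : Prop :=
  ∀ t : Rn n, δ ≤ P.real {ω | γ * ν t ≤ |inner ℝ (X ω) t|}

/-- The `L_r` condition with respect to `ν` with constant `L`:
`(𝔼 |⟨X, t⟩| ^ r) ^ (1 / r) ≤ L ν(t)` for every `t`. The left side takes values in `[0, ∞]`,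
so that the condition includes the finiteness of the moment. -/
def LrCondition {n : ℕ} {Ω : Type*} [MeasurableSpace Ω] (X : Ω → Rn n) (P : Measure Ω)
    (ν : Seminorm ℝ (Rn n)) (r L : ℝ) : Prop :=
  ∀ t : Rn n, eLpNorm (fun ω => inner ℝ (X ω) t) (ENNReal.ofReal r) P ≤ ENNReal.ofReal (L * ν t)

/-- The floating body `K_p(X) = {t : P(⟨X, t⟩ ≥ 1) ≤ exp(-p)}`. -/
def floatingBody {n : ℕ} {Ω : Type*} [MeasurableSpace Ω] (X : Ω → Rn n) (P : Measure Ω)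
    (p : ℝ) : Set (Rn n) :=
  {t | P.real {ω | 1 ≤ inner ℝ (X ω) t} ≤ Real.exp (-p)}

/-- The (one-sided) polar `T° = {x : ⟨t, x⟩ ≤ 1 for every t ∈ T}`. -/
def polarBody {n : ℕ} (T : Set (Rn n)) : Set (Rn n) :=
  {x | ∀ t ∈ T, inner ℝ t x ≤ 1}

/-- `absconv(x₁, …, x_N)`, the convex hull of the points `±x₁, …, ±x_N`. -/
def absconv {n N : ℕ} (x : Fin N → Rn n) : Set (Rn n) :=
  convexHull ℝ (Set.range x ∪ Set.range (fun i => -x i))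

end RandomPolytope

/-!
The theorem is an instance of the `ε`-net theorem of Vapnik–Chervonenkis and Haussler–Welzl for
half-spaces.

By Hahn–Banach separation (`half_polarBody_subset_absconv`) the inclusion holds as soon as every
half-space `{⟪·, t⟫ ≥ 1/2}` with `t ∉ K_p(X)` contains one of the sample points. For such `t` the
smaller half-space `{⟪·, t⟫ ≥ 1}` has probability more than `q = e⁻ᵖ`, so a single half-space is
missed with probability at most `(1 - q)^N ≤ e^(-Nq)`, where `Nq = e^(-α) N^(1-α) n^α`. The point is
to have this uniformly in `t`.

This is done by symmetrization. Draw a second, "ghost" sample of size `N`. If some half-space is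
missed by the sample, then with probability at least `1/2` it contains `m ≈ Nq/4` ghost points
(`measureReal_missing_le_ghostEvent`). The joint law is invariant under exchanging the `i`-th
points of the two samples for any set of indices `i`. For `2N` given points and a given trace of a
half-space on them, at most a `2⁻ᵐ` fraction of the exchanges puts no point of the trace into the
sample and `m` of them into the ghost sample (`card_swaps_single`). Half-spaces with a fixed
threshold have VC dimension at most `n` (`card_le_finrank_of_shattered`), so by Sauer–Shelah there
are at most `(2eN/n)^n` traces, and the probability that some half-space is missed is at most
`2 (2eN/n)^n 2⁻ᵐ`. The factor `(2eN/n)^n = exp(n log(2eN/n))` is negligible against `2⁻ᵐ` once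
`N/n` is large in terms of `α` (`exists_hits`).

The gap between the thresholds `1/2` and `1` is used for measurability: it lets all the events be
replaced by open sets, although they involve uncountably many `t`.
-/

namespace RandomPolytope

/-! ### Traces of half-spaces on finite families of points -/

/-- The class of half-spaces `{x | c < ⟪x, t⟫}` with a fixed threshold `c ≥ 0` has VC dimension at
most `dim E`: a family of more points has a linear relation `∑ gⱼ zⱼ = 0`, which may be taken with
`∑ gⱼ ≥ 0`, and then no half-space of the class cuts out exactly the points with `gⱼ > 0`. -/
lemma card_le_finrank_of_shattered {E κ : Type*} [NormedAddCommGroup E] [InnerProductSpace ℝ E]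
    [FiniteDimensional ℝ E] {c : ℝ} (hc : 0 ≤ c) (z : κ → E) {s : Finset κ}
    (h : ∀ u ⊆ s, ∃ t : E, ∀ j ∈ s, j ∈ u ↔ c < inner ℝ (z j) t) :
    s.card ≤ Module.finrank ℝ E := by
  classical
  have key : ∀ g : s → ℝ, ∑ i, g i • z i = 0 → 0 ≤ ∑ i, g i → (∃ i, g i ≠ 0) → False := by
    rintro g hg hsum ⟨i₀, hi₀⟩
    obtain ⟨i, hi⟩ : ∃ i, 0 < g i := by
      by_contra! hneg
      have h0 : ∑ i, g i = 0 := le_antisymm (Finset.sum_nonpos fun i _ => hneg i) hsum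
      exact hi₀ ((Finset.sum_eq_zero_iff_of_nonpos fun i _ => hneg i).1 h0 i₀ (Finset.mem_univ _))
    obtain ⟨t, ht⟩ := h ((Finset.univ.filter fun i => 0 < g i).map (Function.Embedding.subtype _))
      (fun j hj => by
        obtain ⟨a, -, rfl⟩ := Finset.mem_map.1 hj
        exact a.2)
    have ht' : ∀ j : s, 0 < g j ↔ c < inner ℝ (z j) t := fun j => by
      rw [← ht j j.2]
      simp
    have hlt : ∑ j, g j * c < ∑ j, g j * inner ℝ (z j) t := by
      refine Finset.sum_lt_sum (fun j _ => ?_) ⟨i, Finset.mem_univ _, ?_⟩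
      · rcases lt_or_ge 0 (g j) with hj | hj
        · exact mul_le_mul_of_nonneg_left ((ht' j).1 hj).le hj.le
        · exact mul_le_mul_of_nonpos_left (not_lt.1 fun h' => hj.not_gt ((ht' j).2 h')) hj
      · exact mul_lt_mul_of_pos_left ((ht' i).1 hi) hi
    have hzero : ∑ j, g j * inner ℝ (z j) t = 0 := by
      have := congrArg (fun x => inner ℝ x t) hg
      simpa [sum_inner, inner_smul_left] using this
    rw [hzero, ← Finset.sum_mul] at hlt
    exact absurd hlt (not_lt.2 (mul_nonneg hsum hc))
  by_contra hcard
  have hdep : ¬ LinearIndependent ℝ (fun j : s => z j) := fun hli => by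
    have := hli.fintype_card_le_finrank
    rw [Fintype.card_coe] at this
    exact hcard this
  obtain ⟨g, hg, i, hi⟩ := Fintype.not_linearIndependent_iff.1 hdep
  rcases le_total 0 (∑ i, g i) with hs | hs
  · exact key g hg hs ⟨i, hi⟩
  · refine key (fun i => -g i) ?_ ?_ ⟨i, neg_ne_zero.2 hi⟩
    · simp only [neg_smul, Finset.sum_neg_distrib, hg, neg_zero]
    · simpa using hs

/-- Sauer–Shelah bound for the traces of half-spaces `{x | c < ⟪x, t⟫}` on a finite family. -/
lemma card_traces_le {E κ : Type*} [NormedAddCommGroup E] [InnerProductSpace ℝ E]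
    [FiniteDimensional ℝ E] [Fintype κ] [DecidableEq κ] {c : ℝ} (hc : 0 ≤ c) (z : κ → E)
    {𝒜 : Finset (Finset κ)} (h : ∀ a ∈ 𝒜, ∃ t : E, ∀ j, j ∈ a ↔ c < inner ℝ (z j) t) :
    𝒜.card ≤ ∑ k ∈ Finset.Iic (Module.finrank ℝ E), (Fintype.card κ).choose k := by
  have hdim : 𝒜.vcDim ≤ Module.finrank ℝ E := by
    refine Finset.sup_le fun s hs => card_le_finrank_of_shattered hc z fun u hu => ?_
    obtain ⟨a, ha, rfl⟩ := Finset.mem_shatterer.1 hs hu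
    obtain ⟨t, ht⟩ := h a ha
    exact ⟨t, fun j hj => by simp [hj, ht]⟩
  calc 𝒜.card ≤ 𝒜.shatterer.card := Finset.card_le_card_shatterer 𝒜
    _ ≤ ∑ k ∈ Finset.Iic 𝒜.vcDim, (Fintype.card κ).choose k := Finset.card_shatterer_le_sum_vcDim
    _ ≤ _ := Finset.sum_le_sum_of_subset (Finset.Iic_subset_Iic.2 hdim)

/-- The standard bound `∑_{k ≤ n} C(M, k) ≤ (eM/n)ⁿ`: compare with the binomial expansion of
`(1 + n/M)^M ≤ eⁿ`. -/
lemma sum_choose_le {n M : ℕ} (hn : 0 < n) (hM : n ≤ M) :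
    ∑ k ∈ Finset.Iic n, (M.choose k : ℝ) ≤ (Real.exp 1 * M / n) ^ n := by
  have hn' : (0 : ℝ) < n := by exact_mod_cast hn
  have hM' : (n : ℝ) ≤ M := by exact_mod_cast hM
  have hM0 : (0 : ℝ) < M := hn'.trans_le hM'
  set x : ℝ := n / M with hx
  have hx0 : 0 < x := by positivity
  have hx1 : x ≤ 1 := (div_le_one hM0).2 hM'
  have h1 : (∑ k ∈ Finset.Iic n, (M.choose k : ℝ)) * x ^ n ≤ Real.exp n := by
    calc (∑ k ∈ Finset.Iic n, (M.choose k : ℝ)) * x ^ n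
        ≤ ∑ k ∈ Finset.Iic n, x ^ k * (M.choose k : ℝ) := by
          rw [Finset.sum_mul]
          refine Finset.sum_le_sum fun k hk => ?_
          rw [mul_comm]
          exact mul_le_mul_of_nonneg_right
            (pow_le_pow_of_le_one hx0.le hx1 (Finset.mem_Iic.1 hk)) (Nat.cast_nonneg _)
      _ ≤ ∑ k ∈ Finset.range (M + 1), x ^ k * (M.choose k : ℝ) := by
          refine Finset.sum_le_sum_of_subset_of_nonneg (fun k hk => ?_) fun _ _ _ => by positivity
          have := Finset.mem_Iic.1 hk
          exact Finset.mem_range.2 (by omega)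
      _ = (x + 1) ^ M := by simp [add_pow]
      _ ≤ Real.exp x ^ M := by
          gcongr
          exact Real.add_one_le_exp x
      _ = Real.exp n := by
          rw [← Real.exp_nat_mul, hx, mul_div_cancel₀ _ hM0.ne']
  have h2 : (Real.exp 1 * M / n) ^ n = Real.exp n / x ^ n := by
    rw [hx, ← Real.exp_one_pow, ← div_pow]
    congr 1
    field_simp
  rw [h2, le_div_iff₀ (by positivity)]
  exact h1

/-! ### Symmetrization by random swaps -/

/-- Let `σ` exchange the two points of some of the pairs `(i, false), (i, true)`, so that
`(i, σ i)` becomes the first and `(i, !σ i)` the second point of the `i`-th pair. For a fixed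
set `s`, the exchanges after which `s` contains no first point and at least `m` second points are
prescribed in at least `m` coordinates, hence make up at most a `2⁻ᵐ` fraction of all. -/
lemma card_swaps_single {ι : Type*} [Fintype ι] [DecidableEq ι] (s : Finset (ι × Bool)) (m : ℕ) :
    (Finset.univ.filter fun σ : ι → Bool => (∀ i, (i, σ i) ∉ s) ∧
      m ≤ (Finset.univ.filter fun i => (i, !σ i) ∈ s).card).card * 2 ^ m
      ≤ 2 ^ Fintype.card ι := by
  set F := Finset.univ.filter fun σ : ι → Bool => (∀ i, (i, σ i) ∉ s) ∧
      m ≤ (Finset.univ.filter fun i => (i, !σ i) ∈ s).card with hF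
  rcases F.eq_empty_or_nonempty with h | ⟨σ₀, hσ₀⟩
  · simp [h]
  · obtain ⟨-, h1, h2⟩ := Finset.mem_filter.1 hσ₀
    set J := Finset.univ.filter fun i => (i, !σ₀ i) ∈ s with hJ
    have hsub : F ⊆ Fintype.piFinset fun i => if i ∈ J then {σ₀ i} else Finset.univ := by
      intro σ hσ
      obtain ⟨-, h3, -⟩ := Finset.mem_filter.1 hσ
      refine Fintype.mem_piFinset.2 fun i => ?_
      split_ifs with hi
      · rw [Finset.mem_singleton]
        by_contra hne
        have h4 : (i, !σ₀ i) ∈ s := (Finset.mem_filter.1 hi).2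
        have h5 : σ i = !σ₀ i := by
          revert hne
          cases σ i <;> cases σ₀ i <;> simp
        exact h3 i (h5 ▸ h4)
      · exact Finset.mem_univ _
    have hcard : F.card ≤ 2 ^ Jᶜ.card := by
      refine (Finset.card_le_card hsub).trans_eq ?_
      rw [Fintype.card_piFinset, ← Finset.prod_subset (Finset.subset_univ Jᶜ)]
      · rw [Finset.prod_congr rfl (g := fun _ => 2), Finset.prod_const]
        intro i hi
        simp [Finset.mem_compl.1 hi]
      · intro i _ hi
        simp [by simpa using hi]
    calc F.card * 2 ^ m ≤ 2 ^ Jᶜ.card * 2 ^ J.card :=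
          Nat.mul_le_mul hcard (Nat.pow_le_pow_right two_pos h2)
      _ = 2 ^ Fintype.card ι := by rw [← pow_add, Finset.card_compl_add_card]

/-- Union bound for `card_swaps_single` over a family of sets. -/
lemma card_swaps_family {ι : Type*} [Fintype ι] [DecidableEq ι]
    (𝒜 : Finset (Finset (ι × Bool))) (m : ℕ) :
    (Finset.univ.filter fun σ : ι → Bool => ∃ s ∈ 𝒜, (∀ i, (i, σ i) ∉ s) ∧
      m ≤ (Finset.univ.filter fun i => (i, !σ i) ∈ s).card).card * 2 ^ m
      ≤ 𝒜.card * 2 ^ Fintype.card ι := by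
  have hsub : (Finset.univ.filter fun σ : ι → Bool => ∃ s ∈ 𝒜, (∀ i, (i, σ i) ∉ s) ∧
      m ≤ (Finset.univ.filter fun i => (i, !σ i) ∈ s).card) ⊆
      𝒜.biUnion fun s => Finset.univ.filter fun σ : ι → Bool => (∀ i, (i, σ i) ∉ s) ∧
        m ≤ (Finset.univ.filter fun i => (i, !σ i) ∈ s).card := by
    intro σ hσ
    simpa using hσ
  calc _ ≤ (∑ s ∈ 𝒜, (Finset.univ.filter fun σ : ι → Bool => (∀ i, (i, σ i) ∉ s) ∧
        m ≤ (Finset.univ.filter fun i => (i, !σ i) ∈ s).card).card) * 2 ^ m :=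
        Nat.mul_le_mul_right _ ((Finset.card_le_card hsub).trans Finset.card_biUnion_le)
    _ ≤ ∑ s ∈ 𝒜, 2 ^ Fintype.card ι := by
        rw [Finset.sum_mul]
        exact Finset.sum_le_sum fun s _ => card_swaps_single s m
    _ = _ := by simp

/-- The exchange of the two entries of those pairs `z i` for which `σ i` is true. -/
def swapPairs {ι E : Type*} (σ : ι → Bool) (z : ι → E × E) : ι → E × E :=
  fun i => bif σ i then (z i).swap else z i

lemma measurePreserving_swapPairs {ι E : Type*} [Fintype ι] [MeasurableSpace E] (μ : Measure E)
    [IsProbabilityMeasure μ] (σ : ι → Bool) :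
    MeasurePreserving (swapPairs σ) (Measure.pi fun _ : ι => μ.prod μ)
      (Measure.pi fun _ : ι => μ.prod μ) := by
  refine measurePreserving_pi (fun _ : ι => μ.prod μ) (fun _ : ι => μ.prod μ)
    (f := fun i p => bif σ i then p.swap else p) fun i => ?_
  cases σ i
  · exact MeasurePreserving.id _
  · exact Measure.measurePreserving_swap

/-- If every orbit under the exchanges `swapPairs σ` meets `W` in at most a `S / 2ᵐ` fraction,
then `W` has measure at most `S / 2ᵐ`, since these exchanges preserve the measure. -/
lemma measure_mul_le_of_card_swaps {ι E : Type*} [Fintype ι] [DecidableEq ι] [MeasurableSpace E]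
    (μ : Measure E) [IsProbabilityMeasure μ] {W : Set (ι → E × E)} (hW : MeasurableSet W)
    {S m : ℕ}
    (h : ∀ z, ∀ F : Finset (ι → Bool), (∀ σ ∈ F, swapPairs σ z ∈ W) →
      F.card * 2 ^ m ≤ S * 2 ^ Fintype.card ι) :
    (Measure.pi fun _ : ι => μ.prod μ).real W * 2 ^ m ≤ S := by
  classical
  set ν := Measure.pi fun _ : ι => μ.prod μ with hν
  have hmeas : ∀ σ : ι → Bool, MeasurableSet (swapPairs σ ⁻¹' W) := fun σ =>
    (measurePreserving_swapPairs μ σ).measurable hW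
  have h1 : ∀ σ : ι → Bool,
      ∫ z, (swapPairs σ ⁻¹' W).indicator (fun _ => (1 : ℝ)) z ∂ν = ν.real W := fun σ => by
    rw [integral_indicator_const _ (hmeas σ), smul_eq_mul, mul_one]
    exact (measurePreserving_swapPairs μ σ).measureReal_preimage hW.nullMeasurableSet
  have hint : ∀ σ : ι → Bool,
      Integrable ((swapPairs σ ⁻¹' W).indicator (fun _ => (1 : ℝ))) ν := fun σ =>
    (integrable_const (1 : ℝ)).indicator (hmeas σ)
  have h2 : (2 : ℝ) ^ Fintype.card ι * ν.real W
      = ∫ z, ∑ σ : ι → Bool, (swapPairs σ ⁻¹' W).indicator (fun _ => (1 : ℝ)) z ∂ν := by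
    rw [integral_finsetSum _ fun σ _ => hint σ, Finset.sum_congr rfl fun σ _ => h1 σ]
    simp
  have h3 : ∫ z, ∑ σ : ι → Bool, (swapPairs σ ⁻¹' W).indicator (fun _ => (1 : ℝ)) z ∂ν
      ≤ ∫ _, (S : ℝ) * 2 ^ Fintype.card ι / 2 ^ m ∂ν := by
    refine integral_mono (integrable_finsetSum _ fun σ _ => hint σ) (integrable_const _)
      fun z => ?_
    have := h z (Finset.univ.filter fun σ => swapPairs σ z ∈ W)
      fun σ hσ => (Finset.mem_filter.1 hσ).2
    have h4 : ∑ σ : ι → Bool, (swapPairs σ ⁻¹' W).indicator (fun _ => (1 : ℝ)) z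
        = (Finset.univ.filter fun σ => swapPairs σ z ∈ W).card := by
      simp [Set.indicator_apply]
    simp only [h4]
    rw [le_div_iff₀ (by positivity)]
    exact_mod_cast this
  rw [← h2, integral_const, probReal_univ, one_smul, le_div_iff₀ (by positivity)] at h3
  have h5 : (0 : ℝ) < 2 ^ Fintype.card ι := by positivity
  nlinarith

/-! ### Samples that miss a half-space of large measure -/

/-- Lower tail of a binomial variable, by Markov's inequality for `2⁻ᵏ`, where `k` is the number
of sample points in `A`. -/
lemma measureReal_few_hits_le {ι E : Type*} [Fintype ι] [MeasurableSpace E] (μ : Measure E)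
    [IsProbabilityMeasure μ] {A : Set E} [DecidablePred (· ∈ A)] (hA : MeasurableSet A) {q : ℝ}
    (hq : q ≤ μ.real A) (m : ℕ) :
    (Measure.pi fun _ : ι => μ).real {y | (Finset.univ.filter fun i => y i ∈ A).card < m}
      ≤ 2 ^ m * (1 - q / 2) ^ Fintype.card ι := by
  set f : E → ℝ := fun x => if x ∈ A then 1 / 2 else 1 with hf
  have hf_eq : f = fun x => 1 - A.indicator (fun _ => (1 / 2 : ℝ)) x := by
    ext x
    by_cases hx : x ∈ A <;> simp [hf, hx] <;> norm_num
  have hf_int : Integrable f μ := by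
    rw [hf_eq]
    exact (integrable_const _).sub ((integrable_const _).indicator hA)
  have hfI : ∫ x, f x ∂μ = 1 - μ.real A / 2 := by
    rw [hf_eq, integral_sub (integrable_const _) ((integrable_const _).indicator hA),
      integral_indicator_const _ hA]
    simp [div_eq_mul_inv]
  have hprod : ∀ y : ι → E,
      ∏ i, f (y i) = (1 / 2) ^ (Finset.univ.filter fun i => y i ∈ A).card := fun y => by
    simp [hf, Finset.prod_ite]
  have hmarkov := mul_meas_ge_le_integral_of_nonneg (μ := Measure.pi fun _ : ι => μ)
    (f := fun y => ∏ i, f (y i))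
    (Filter.Eventually.of_forall fun y => by
      change 0 ≤ ∏ i, f (y i)
      rw [hprod]
      positivity)
    (Integrable.fintype_prod fun _ => hf_int) ((1 / 2) ^ m)
  rw [integral_fintype_prod_eq_pow f, hfI] at hmarkov
  have hsub : (Measure.pi fun _ : ι => μ).real
      {y | (Finset.univ.filter fun i => y i ∈ A).card < m}
      ≤ (Measure.pi fun _ : ι => μ).real {y | (1 / 2) ^ m ≤ ∏ i, f (y i)} := by
    refine measureReal_mono fun y hy => ?_
    rw [Set.mem_ofPred_eq, hprod]
    exact pow_le_pow_of_le_one (by norm_num) (by norm_num) (le_of_lt hy)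
  have hpow : (1 - μ.real A / 2) ^ Fintype.card ι ≤ (1 - q / 2) ^ Fintype.card ι :=
    pow_le_pow_left₀ (by linarith [measureReal_le_one (μ := μ) (s := A)]) (by linarith) _
  refine hsub.trans ?_
  have h2 : (2 : ℝ) ^ m * (1 / 2) ^ m = 1 := by rw [← mul_pow]; norm_num
  calc _ = 2 ^ m * ((1 / 2) ^ m *
        (Measure.pi fun _ : ι => μ).real {y | (1 / 2) ^ m ≤ ∏ i, f (y i)}) := by
        rw [← mul_assoc, h2, one_mul]
    _ ≤ _ := mul_le_mul_of_nonneg_left (hmarkov.trans hpow) (by positivity)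

lemma isOpen_le_card_filter_lt {ι X : Type*} [Fintype ι] [TopologicalSpace X] {f : ι → X → ℝ}
    (hf : ∀ i, Continuous (f i)) (c : ℝ) (m : ℕ) :
    IsOpen {x | m ≤ (Finset.univ.filter fun i => c < f i x).card} := by
  have h : {x | m ≤ (Finset.univ.filter fun i => c < f i x).card}
      = ⋃ J : {J : Finset ι // m ≤ J.card}, ⋂ i ∈ J.1, {x | c < f i x} := by
    ext x
    simp only [Set.mem_ofPred_eq, Set.mem_iUnion, Set.mem_iInter, Subtype.exists, exists_prop]
    refine ⟨fun hx => ⟨_, hx, fun i hi => (Finset.mem_filter.1 hi).2⟩, ?_⟩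
    rintro ⟨J, hJ, hx⟩
    exact hJ.trans (Finset.card_le_card fun i hi => by simpa using hx i hi)
  rw [h]
  exact isOpen_iUnion fun J => isOpen_biInter_finset fun i _ =>
    isOpen_lt continuous_const (hf i)

lemma isOpen_missing_samples {ι E : Type*} [Fintype ι] [NormedAddCommGroup E]
    [InnerProductSpace ℝ E] (T : Set E) (c : ℝ) :
    IsOpen {x : ι → E | ∃ t ∈ T, ∀ i, inner ℝ (x i) t < c} := by
  have h : {x : ι → E | ∃ t ∈ T, ∀ i, inner ℝ (x i) t < c}
      = ⋃ t ∈ T, ⋂ i, {x | inner ℝ (x i) t < c} := by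
    ext x
    simp
  rw [h]
  exact isOpen_biUnion fun t _ => isOpen_iInter_of_finite fun i =>
    isOpen_lt (by fun_prop) continuous_const

/-- The pairs `(x, y)` of samples such that, for some `t ∈ T`, no point of `x` lies in the closed
half-space `{c ≤ ⟪·, t⟫}` while at least `m` points of the ghost sample `y` lie in its interior.
One condition uses the closed and the other the open half-space so that this set is open, hence
measurable, for arbitrary `T`. -/
def ghostEvent {ι E : Type*} [Fintype ι] [NormedAddCommGroup E] [InnerProductSpace ℝ E]
    (T : Set E) (c : ℝ) (m : ℕ) : Set ((ι → E) × (ι → E)) :=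
  {p | ∃ t ∈ T, (∀ i, inner ℝ (p.1 i) t < c) ∧
    m ≤ (Finset.univ.filter fun i => c < inner ℝ (p.2 i) t).card}

lemma isOpen_ghostEvent {ι E : Type*} [Fintype ι] [NormedAddCommGroup E]
    [InnerProductSpace ℝ E] (T : Set E) (c : ℝ) (m : ℕ) :
    IsOpen (ghostEvent (ι := ι) T c m) := by
  have h : ghostEvent (ι := ι) T c m
      = ⋃ t ∈ T, (⋂ i, {p : (ι → E) × (ι → E) | inner ℝ (p.1 i) t < c}) ∩
        {p | m ≤ (Finset.univ.filter fun i => c < inner ℝ (p.2 i) t).card} := by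
    ext p
    simp [ghostEvent, and_left_comm]
  rw [h]
  exact isOpen_biUnion fun t _ => (isOpen_iInter_of_finite fun i =>
    isOpen_lt (by fun_prop) continuous_const).inter
      (isOpen_le_card_filter_lt (fun i => by fun_prop) c m)

/-- A fixed half-space of measure at least `q` contains `m` points of the ghost sample with
probability at least `1/2`, so passing to the ghost event costs at most a factor of `2`. -/
lemma measureReal_missing_le_ghostEvent {ι E : Type*} [Fintype ι] [NormedAddCommGroup E]
    [InnerProductSpace ℝ E] [SecondCountableTopology E] [MeasurableSpace E] [BorelSpace E]
    (μ : Measure E) [IsProbabilityMeasure μ] {T : Set E} {c q : ℝ} {m : ℕ}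
    (hT : ∀ t ∈ T, q ≤ μ.real {x | c < inner ℝ x t})
    (hm : 2 ^ m * (1 - q / 2) ^ Fintype.card ι ≤ 1 / 2) :
    (Measure.pi fun _ : ι => μ).real {x | ∃ t ∈ T, ∀ i, inner ℝ (x i) t < c}
      ≤ 2 * ((Measure.pi fun _ : ι => μ).prod (Measure.pi fun _ : ι => μ)).real
        (ghostEvent T c m) := by
  classical
  set ρ := Measure.pi fun _ : ι => μ with hρ
  set U := {x : ι → E | ∃ t ∈ T, ∀ i, inner ℝ (x i) t < c} with hU
  have hUm : MeasurableSet U := (isOpen_missing_samples T c).measurableSet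
  have hGm : MeasurableSet (ghostEvent (ι := ι) T c m) := (isOpen_ghostEvent T c m).measurableSet
  have hslice : ∀ x ∈ U, ENNReal.ofReal (1 / 2) ≤ ρ (Prod.mk x ⁻¹' ghostEvent T c m) := by
    rintro x ⟨t, ht, hx⟩
    have hsub : {y : ι → E | m ≤ (Finset.univ.filter fun i => c < inner ℝ (y i) t).card}
        ⊆ Prod.mk x ⁻¹' ghostEvent T c m := fun y hy => ⟨t, ht, hx, hy⟩
    have hfew := measureReal_few_hits_le (ι := ι) μ (A := {x | c < inner ℝ x t})
      (isOpen_lt continuous_const (by fun_prop)).measurableSet (hT t ht) m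
    have hmeas : MeasurableSet
        {y : ι → E | m ≤ (Finset.univ.filter fun i => c < inner ℝ (y i) t).card} :=
      (isOpen_le_card_filter_lt (fun i => by fun_prop) c m).measurableSet
    have hcompl := probReal_compl_eq_one_sub (μ := ρ) hmeas
    have heq : {y : ι → E | m ≤ (Finset.univ.filter fun i => c < inner ℝ (y i) t).card}ᶜ
        = {y | (Finset.univ.filter fun i => y i ∈ {x | c < inner ℝ x t}).card < m} := by
      ext y
      simp
    rw [heq] at hcompl
    refine le_trans ?_ (measure_mono hsub)
    rw [ENNReal.ofReal_le_iff_le_toReal (measure_ne_top _ _)]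
    change 1 / 2 ≤ ρ.real _
    linarith
  have hfub : ENNReal.ofReal (1 / 2) * ρ U ≤ (ρ.prod ρ) (ghostEvent T c m) := by
    rw [Measure.prod_apply hGm, ← lintegral_indicator_const hUm]
    refine lintegral_mono fun x => ?_
    by_cases hx : x ∈ U
    · simpa only [Set.indicator_of_mem hx] using hslice x hx
    · simp [hx]
  have := ENNReal.toReal_mono (measure_ne_top _ _) hfub
  rw [ENNReal.toReal_mul, ENNReal.toReal_ofReal (by norm_num)] at this
  change 1 / 2 * ρ.real U ≤ (ρ.prod ρ).real _ at this
  linarith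

/-- Exchanging points between the two samples preserves the measure, and by
`card_swaps_family` and `card_traces_le` only a small fraction of all exchanges of a given
pair of samples leads into the ghost event. -/
lemma measureReal_ghostEvent_le {ι E : Type*} [Fintype ι] [NormedAddCommGroup E]
    [InnerProductSpace ℝ E] [FiniteDimensional ℝ E] [SecondCountableTopology E]
    [MeasurableSpace E] [BorelSpace E]
    (μ : Measure E) [IsProbabilityMeasure μ] (T : Set E) {c : ℝ} (hc : 0 ≤ c) (m : ℕ) :
    ((Measure.pi fun _ : ι => μ).prod (Measure.pi fun _ : ι => μ)).real (ghostEvent T c m) * 2 ^ m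
      ≤ ∑ k ∈ Finset.Iic (Module.finrank ℝ E), ((2 * Fintype.card ι).choose k : ℝ) := by
  classical
  have hmp := measurePreserving_arrowProdEquivProdArrow E E ι (fun _ => μ) (fun _ => μ)
  have hGm : MeasurableSet (ghostEvent (ι := ι) T c m) := (isOpen_ghostEvent T c m).measurableSet
  rw [← hmp.measureReal_preimage hGm.nullMeasurableSet]
  have key := measure_mul_le_of_card_swaps (ι := ι) μ (hmp.measurable hGm) (m := m)
    (S := ∑ k ∈ Finset.Iic (Module.finrank ℝ E), (2 * Fintype.card ι).choose k) ?_
  · exact_mod_cast key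
  · intro z F hF
    set w : ι × Bool → E := fun p => bif p.2 then (z p.1).2 else (z p.1).1 with hw
    have hfst : ∀ (σ : ι → Bool) i, (swapPairs σ z i).1 = w (i, σ i) := fun σ i => by
      cases h : σ i <;> simp [swapPairs, hw, h]
    have hsnd : ∀ (σ : ι → Bool) i, (swapPairs σ z i).2 = w (i, !σ i) := fun σ i => by
      cases h : σ i <;> simp [swapPairs, hw, h]
    set 𝒜 : Finset (Finset (ι × Bool)) :=
      Finset.univ.filter fun a => ∃ t : E, ∀ j, j ∈ a ↔ c < inner ℝ (w j) t with h𝒜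
    have hcard : 𝒜.card ≤ ∑ k ∈ Finset.Iic (Module.finrank ℝ E),
        (2 * Fintype.card ι).choose k := by
      have := card_traces_le hc w (𝒜 := 𝒜) fun a ha => (Finset.mem_filter.1 ha).2
      rwa [Fintype.card_prod, Fintype.card_bool, mul_comm] at this
    have hFsub : F ⊆ Finset.univ.filter fun σ : ι → Bool => ∃ s ∈ 𝒜, (∀ i, (i, σ i) ∉ s) ∧
        m ≤ (Finset.univ.filter fun i => (i, !σ i) ∈ s).card := by
      intro σ hσ
      obtain ⟨t, -, hmiss, hhit⟩ := hF σ hσ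
      refine Finset.mem_filter.2 ⟨Finset.mem_univ _,
        Finset.univ.filter fun j => c < inner ℝ (w j) t, ?_, fun i hi => ?_, ?_⟩
      · exact Finset.mem_filter.2 ⟨Finset.mem_univ _, t, fun j => by simp⟩
      · have h1 := (Finset.mem_filter.1 hi).2
        have h2 : inner ℝ (swapPairs σ z i).1 t < c := hmiss i
        rw [hfst] at h2
        exact lt_asymm h1 h2
      · refine le_trans hhit (Finset.card_le_card fun i hi => ?_)
        have h2 : c < inner ℝ (swapPairs σ z i).2 t := (Finset.mem_filter.1 hi).2
        rw [hsnd] at h2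
        simpa using h2
    calc F.card * 2 ^ m ≤ _ := Nat.mul_le_mul_right _ (Finset.card_le_card hFsub)
      _ ≤ _ := card_swaps_family 𝒜 m
      _ ≤ _ := Nat.mul_le_mul_right _ hcard

/-- The `ε`-net theorem for half-spaces: if all the half-spaces `{c < ⟪·, t⟫}`, `t ∈ T`, have
measure at least `q`, then with high probability none of the closed ones is missed by the
sample. -/
lemma measureReal_missing_le {ι E : Type*} [Fintype ι] [NormedAddCommGroup E]
    [InnerProductSpace ℝ E] [FiniteDimensional ℝ E] [SecondCountableTopology E]
    [MeasurableSpace E] [BorelSpace E]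
    (μ : Measure E) [IsProbabilityMeasure μ] {T : Set E} {c q : ℝ} (hc : 0 ≤ c) {m : ℕ}
    (hT : ∀ t ∈ T, q ≤ μ.real {x | c < inner ℝ x t})
    (hm : 2 ^ m * (1 - q / 2) ^ Fintype.card ι ≤ 1 / 2) :
    (Measure.pi fun _ : ι => μ).real {x | ∃ t ∈ T, ∀ i, inner ℝ (x i) t < c} * 2 ^ m
      ≤ 2 * ∑ k ∈ Finset.Iic (Module.finrank ℝ E), ((2 * Fintype.card ι).choose k : ℝ) := by
  have h1 := measureReal_missing_le_ghostEvent (ι := ι) μ hT hm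
  have h2 := measureReal_ghostEvent_le (ι := ι) μ T hc m
  have h3 : (0 : ℝ) < 2 ^ m := by positivity
  nlinarith [mul_le_mul_of_nonneg_right h1 h3.le]

/-! ### Polarity -/

/-- If every half-space `{1/2 ≤ ⟪·, t⟫}` with `t ∉ K` contains one of the points, then
`½ K° ⊆ absconv x`: a point `½ y` outside can be separated by some `t`, normalized so that
`⟪xᵢ, t⟫ < 1/2 < ⟪½ y, t⟫`, and then `⟪y, t⟫ > 1` excludes `t ∈ K`. -/
lemma half_polarBody_subset_absconv {n N : ℕ} (hN : 0 < N) (x : Fin N → Rn n) {K : Set (Rn n)}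
    (h : ∀ t ∉ K, ∃ i, 1 / 2 ≤ inner ℝ (x i) t) :
    (1 / 2 : ℝ) • polarBody K ⊆ absconv x := by
  rintro _ ⟨y, hy, rfl⟩
  by_contra hnot
  have hclosed : IsClosed (absconv x) :=
    (((Set.finite_range x).union (Set.finite_range _)).isCompact_convexHull ℝ).isClosed
  obtain ⟨f, u, hfu, huf⟩ := geometric_hahn_banach_closed_point (convex_convexHull ℝ _) hclosed hnot
  have hpos : ∀ i, f (x i) < u := fun i => hfu _ (subset_convexHull ℝ _ (Or.inl ⟨i, rfl⟩))
  have hneg : ∀ i, f (-x i) < u := fun i => hfu _ (subset_convexHull ℝ _ (Or.inr ⟨i, rfl⟩))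
  have hu : 0 < u := by
    have h1 := hpos ⟨0, hN⟩
    have h2 := hneg ⟨0, hN⟩
    rw [map_neg] at h2
    linarith
  set t₀ : Rn n := (InnerProductSpace.toDual ℝ (Rn n)).symm f with ht₀
  have hinner : ∀ v, inner ℝ v ((2 * u)⁻¹ • t₀) = (2 * u)⁻¹ * f v := fun v => by
    rw [inner_smul_right, real_inner_comm, InnerProductSpace.toDual_symm_apply]
  have htK : (2 * u)⁻¹ • t₀ ∉ K := fun ht => by
    have h1 := hy _ ht
    rw [real_inner_comm, hinner, inv_mul_le_iff₀ (by positivity)] at h1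
    have h2 : f ((1 / 2 : ℝ) • y) = 1 / 2 * f y := by simp
    have h3 : u < f ((1 / 2 : ℝ) • y) := huf
    linarith
  obtain ⟨i, hi⟩ := h _ htK
  rw [hinner, le_inv_mul_iff₀ (by positivity)] at hi
  linarith [hpos i]

/-! ### Choice of the parameters -/

lemma exists_ratio_threshold (α : ℝ) :
    ∃ C : ℝ, 1 ≤ C ∧ (α < 1 → ∀ R, C ≤ R → 3 + Real.log R ≤ R ^ (1 - α) / 25) := by
  by_cases hα : α < 1
  · have hβ : 0 < 1 - α := by linarith
    have h1 := (isLittleO_log_rpow_atTop hβ).bound (show (0 : ℝ) < 1 / 50 by norm_num)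
    have h2 := (tendsto_rpow_atTop hβ).eventually_ge_atTop 150
    obtain ⟨C, hC⟩ := Filter.eventually_atTop.1 (h1.and h2)
    refine ⟨max C 1, le_max_right _ _, fun _ R hR => ?_⟩
    obtain ⟨h3, h4⟩ := hC R ((le_max_left _ _).trans hR)
    rw [Real.norm_eq_abs, Real.norm_eq_abs, abs_of_nonneg (a := R ^ (1 - α)) (by linarith)] at h3
    have := le_abs_self (Real.log R)
    linarith
  · exact ⟨1, le_rfl, fun h => absurd h hα⟩

/-- With `q = e⁻ᵖ`, the number `m ≈ Nq / 4` of hits is far enough below the mean `Nq` for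
`measureReal_missing_le_ghostEvent`, and `2⁻ᵐ` beats the number of traces because
`Nq = e^(-α) N^(1-α) n^α` dominates `n log (N/n)` for large `N / n`. -/
lemma exists_hits {α : ℝ} (hα0 : 0 < α) (hα1 : α < 1) {n N : ℕ} (hn : 0 < n) (hnN : n ≤ N)
    (hR : 3 + Real.log ((N : ℝ) / n) ≤ ((N : ℝ) / n) ^ (1 - α) / 25) :
    ∃ m : ℕ, 2 ^ m * (1 - Real.exp (-(α * Real.log (Real.exp 1 * N / n))) / 2) ^ N ≤ 1 / 2 ∧
      2 * (Real.exp 1 * (2 * N : ℕ) / n) ^ n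
        ≤ 2 * Real.exp (-(1 / 50 * (N : ℝ) ^ (1 - α) * (n : ℝ) ^ α)) * 2 ^ m := by
  have hn' : (0 : ℝ) < n := by exact_mod_cast hn
  have hn1 : (1 : ℝ) ≤ n := by exact_mod_cast hn
  have hNn : (n : ℝ) ≤ N := by exact_mod_cast hnN
  set R : ℝ := (N : ℝ) / n with hRdef
  have hR1 : 1 ≤ R := (one_le_div hn').2 hNn
  have hR0 : 0 < R := by linarith
  have hNR : (N : ℝ) = R * n := by rw [hRdef, div_mul_cancel₀ _ hn'.ne']
  have hlogR : 0 ≤ Real.log R := Real.log_nonneg hR1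
  have hlog : Real.log (Real.exp 1 * N / n) = 1 + Real.log R := by
    rw [mul_div_assoc, ← hRdef, Real.log_mul (Real.exp_ne_zero _) hR0.ne', Real.log_exp]
  set q : ℝ := Real.exp (-(α * Real.log (Real.exp 1 * N / n))) with hq
  have hq0 : 0 < q := Real.exp_pos _
  have hq1 : q ≤ 1 := Real.exp_le_one_iff.2 (by rw [hlog]; nlinarith)
  have hV : (N : ℝ) ^ (1 - α) * (n : ℝ) ^ α = n * R ^ (1 - α) := by
    rw [hNR, Real.mul_rpow hR0.le hn'.le, mul_assoc, ← Real.rpow_add hn', sub_add_cancel,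
      Real.rpow_one, mul_comm]
  set V : ℝ := n * R ^ (1 - α) with hVdef
  have hQ : N * q = Real.exp (-α) * V := by
    have h1 : R * q = Real.exp (-α) * R ^ (1 - α) := by
      rw [hq, hlog, Real.rpow_def_of_pos hR0, ← Real.exp_add]
      nth_rw 1 [← Real.exp_log hR0]
      rw [← Real.exp_add]
      congr 1
      ring
    rw [hVdef, hNR]
    linear_combination (n : ℝ) * h1
  have hexp : (0.36 : ℝ) ≤ Real.exp (-α) := by
    have h1 := Real.exp_one_lt_d9
    have h2 : Real.exp (-1) ≤ Real.exp (-α) := Real.exp_le_exp.2 (by linarith)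
    have h3 : Real.exp (-1) * Real.exp 1 = 1 := by rw [← Real.exp_add]; simp
    nlinarith [Real.exp_pos (-1)]
  have hV75 : n * (3 + Real.log R) ≤ V / 25 := by
    rw [hVdef, mul_div_assoc]
    exact mul_le_mul_of_nonneg_left hR hn'.le
  have hV0 : 75 ≤ V := by nlinarith
  set Q : ℝ := N * q with hQdef
  have hQV : 0.36 * V ≤ Q := by rw [hQ]; nlinarith
  have hl1 := Real.log_two_gt_d9
  have hl2 := Real.log_two_lt_d9
  have hpow2 : ∀ m : ℕ, (2 : ℝ) ^ m = Real.exp (m * Real.log 2) := fun m => by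
    rw [Real.exp_nat_mul, Real.exp_log two_pos]
  have hmle : (⌊Q / 4⌋₊ : ℝ) ≤ Q / 4 := Nat.floor_le (by linarith)
  have hmge : Q / 4 - 1 < ⌊Q / 4⌋₊ := Nat.sub_one_lt_floor _
  refine ⟨⌊Q / 4⌋₊, ?_, ?_⟩
  · have h1 : (1 - q / 2) ^ N ≤ Real.exp (-(Q / 2)) := by
      calc (1 - q / 2) ^ N ≤ Real.exp (-(q / 2)) ^ N :=
            pow_le_pow_left₀ (by linarith) (by linarith [Real.add_one_le_exp (-(q / 2))]) _
        _ = Real.exp (-(Q / 2)) := by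
            rw [← Real.exp_nat_mul, hQdef]
            congr 1
            ring
    calc _ ≤ Real.exp (⌊Q / 4⌋₊ * Real.log 2) * Real.exp (-(Q / 2)) := by
          rw [hpow2]
          exact mul_le_mul_of_nonneg_left h1 (Real.exp_pos _).le
      _ ≤ Real.exp (-Real.log 2) := by
          rw [← Real.exp_add]
          exact Real.exp_le_exp.2 (by nlinarith)
      _ = 1 / 2 := by rw [Real.exp_neg, Real.exp_log two_pos, one_div]
  · have h1 : Real.exp 1 * (2 * N : ℕ) / n = Real.exp (1 + Real.log 2 + Real.log R) := by
      rw [Real.exp_add, Real.exp_add, Real.exp_log two_pos, Real.exp_log hR0, hRdef]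
      push_cast
      ring
    rw [h1, ← Real.exp_nat_mul, hpow2, mul_assoc (1 / 50 : ℝ), hV, mul_assoc, ← Real.exp_add]
    refine mul_le_mul_of_nonneg_left (Real.exp_le_exp.2 ?_) two_pos.le
    nlinarith

end RandomPolytope

theorem theorem1p4 :
    ∃ c₁ : ℝ, 0 < c₁ ∧
    ∃ c₀ : ℝ → ℝ → ℝ → ℝ → ℝ, (∀ α δ r κ : ℝ, 0 < c₀ α δ r κ) ∧
    ∀ (α δ r γ L : ℝ), 0 < α → α < 1 → 0 < δ → 0 < r → 0 < γ → 0 < L →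
    ∀ (n N : ℕ), 0 < n → c₀ α δ r (L / γ) * (n : ℝ) ≤ (N : ℝ) →
    -- a norm on `ℝⁿ`: a seminorm that vanishes only at `0`
    ∀ (ν : Seminorm ℝ (RandomPolytope.Rn n)), (∀ t, ν t = 0 → t = 0) →
    -- the random vector `X`
    ∀ (Ω₀ : Type*) [MeasurableSpace Ω₀] (P₀ : Measure Ω₀) [IsProbabilityMeasure P₀]
      (X : Ω₀ → RandomPolytope.Rn n), AEMeasurable X P₀ →
      RandomPolytope.IsSymmetric X P₀ →
      RandomPolytope.SmallBall X P₀ ν γ δ →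
      RandomPolytope.LrCondition X P₀ ν r L →
    -- independent copies `X₁, …, X_N` of `X`
    ∀ (Ω : Type*) [MeasurableSpace Ω] (P : Measure Ω) [IsProbabilityMeasure P]
      (Y : Fin N → Ω → RandomPolytope.Rn n),
      iIndepFun Y P → (∀ i, IdentDistrib (Y i) X P P₀) →
    ∃ E : Set Ω, MeasurableSet E ∧
      1 - 2 * Real.exp (-(c₁ * (N : ℝ) ^ (1 - α) * (n : ℝ) ^ α)) ≤ P.real E ∧
      ∀ ω ∈ E,
        (1 / 2 : ℝ) • RandomPolytope.polarBody
            (RandomPolytope.floatingBody X P₀ (α * Real.log (Real.exp 1 * (N : ℝ) / (n : ℝ))))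
          ⊆ RandomPolytope.absconv (fun i => Y i ω) := by
  choose C hC1 hC using RandomPolytope.exists_ratio_threshold
  refine ⟨1 / 50, by norm_num, fun α _ _ _ => C α, fun α _ _ _ => zero_lt_one.trans_le (hC1 α), ?_⟩
  intro α δ r γ L hα0 hα1 _ _ _ _ n N hn hnN ν _ Ω₀ _ P₀ _ X hX _ _ _ Ω _ P _ Y hindep hident
  have hn' : (0 : ℝ) < n := by exact_mod_cast hn
  have hnN' : n ≤ N := by
    have : (n : ℝ) ≤ N := le_trans (le_mul_of_one_le_left hn'.le (hC1 α)) hnN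
    exact_mod_cast this
  have hR := hC α hα1 _ ((le_div_iff₀ hn').2 hnN)
  obtain ⟨m, hm1, hm2⟩ := RandomPolytope.exists_hits hα0 hα1 hn hnN' hR
  set p : ℝ := α * Real.log (Real.exp 1 * N / n) with hp
  set K := RandomPolytope.floatingBody X P₀ p with hK
  set μ : Measure (RandomPolytope.Rn n) := P₀.map X with hμ
  have : IsProbabilityMeasure μ := Measure.isProbabilityMeasure_map hX
  have hY : ∀ i, AEMeasurable (Y i) P := fun i => (hident i).aemeasurable_fst
  have hT : ∀ t ∈ Kᶜ, Real.exp (-p) ≤ μ.real {x | 1 / 2 < inner ℝ x t} := by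
    intro t ht
    have h1 : Real.exp (-p) < P₀.real {ω | 1 ≤ inner ℝ (X ω) t} := not_le.1 ht
    have h2 : μ.real {x | 1 / 2 < inner ℝ x t} = P₀.real {ω | 1 / 2 < inner ℝ (X ω) t} :=
      map_measureReal_apply_of_aemeasurable hX
        (isOpen_lt continuous_const (by fun_prop)).measurableSet
    rw [h2]
    refine h1.le.trans (measureReal_mono fun ω hω => ?_)
    have h3 : 1 ≤ inner ℝ (X ω) t := hω
    exact lt_of_lt_of_le (by norm_num) h3
  set U := {x : Fin N → RandomPolytope.Rn n | ∃ t ∈ Kᶜ, ∀ i, inner ℝ (x i) t < 1 / 2} with hU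
  have hUm : MeasurableSet U := (RandomPolytope.isOpen_missing_samples Kᶜ (1 / 2)).measurableSet
  have hlaw : P.map (fun ω i => Y i ω) = Measure.pi fun _ : Fin N => μ := by
    rw [(iIndepFun_iff_map_fun_eq_pi_map hY).1 hindep]
    exact congrArg Measure.pi (funext fun i => (hident i).map_eq)
  have hPU : P.real ((fun ω i => Y i ω) ⁻¹' U)
      ≤ 2 * Real.exp (-(1 / 50 * (N : ℝ) ^ (1 - α) * (n : ℝ) ^ α)) := by
    have h1 := RandomPolytope.measureReal_missing_le (ι := Fin N) μ (by norm_num) hT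
      (by simpa using hm1)
    rw [← hU, ← hlaw, map_measureReal_apply_of_aemeasurable (aemeasurable_pi_lambda _ hY) hUm,
      Fintype.card_fin, finrank_euclideanSpace_fin] at h1
    have h2 := RandomPolytope.sum_choose_le hn (show n ≤ 2 * N by omega)
    have h3 := h1.trans ((mul_le_mul_of_nonneg_left h2 two_pos.le).trans hm2)
    exact le_of_mul_le_mul_right h3 (by positivity)
  -- The event that some half-space is missed may be only null-measurable, as the `Y i` are just
  -- a.e. measurable; hence the measurable hull.
  refine ⟨(toMeasurable P ((fun ω i => Y i ω) ⁻¹' U))ᶜ, (measurableSet_toMeasurable _ _).compl,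
    ?_, fun ω hω => ?_⟩
  · rw [probReal_compl_eq_one_sub (measurableSet_toMeasurable _ _), measureReal_def,
      measure_toMeasurable]
    rw [measureReal_def] at hPU
    linarith
  · refine RandomPolytope.half_polarBody_subset_absconv (hn.trans_le hnN') _ fun t ht => ?_
    by_contra! hmiss
    exact hω (subset_toMeasurable _ _ ⟨t, ht, hmiss⟩)
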